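/- Theorem 2.4. For a homomorphism $p : B \to E$ of commutative rings (with $1$), regard $E$ as a $B$-module through $p$. Call $p$ *pure* if for every $B$-module $N$ the map $N \otimes_B p : N \otimes_B B \to N \otimes_B E$ is injective. A *descent datum relative to $p$* is an $E$-module $N$ with an $(E \otimes_B E)$-linear map $\theta : i_1^*N \to i_2^*N$, where $i_1, i_2 : E \to E \otimes_B E$ are $i_1(e) = e \otimes 1$ and $i_2(e) = 1 \otimes e$ and $(-)^*$ denotes extension of scalars, such that, up to the canonical isomorphisms, extending $\theta$ along the multiplication $E \otimes_B E \to E$ gives $\mathrm{id}_N$, and $\theta_{23} \circ \theta_{12} = \theta_{13}$ over $E \otimes_B E \otimes_B E$, where $\theta_{kl}$ is the extension of $\theta$ along the map $E \otimes_B E \to E \otimes_B E \otimes_B E$ onto the $k$-th and $l$-th factors (it follows that $\theta$ is invertible). Morphisms of descent data are the $E$-linear maps compatible with the maps $\theta$. Call $p$ an *effective descent morphism for modules* if the canonical functor $M \mapsto E \otimes_B M$ from $\mathbf{Mod}_B$ to the category of descent data relative to $p$ is an equivalence of categories. Then $p$ is an effective descent morphism for modules if and only if $p$ is pure. Likewise,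 the functor $E \otimes_B - : \mathbf{Mod}_B \to \mathbf{Mod}_E$ is comonadic (that is, the comparison functor from $\mathbf{Mod}_B$ to the category of coalgebras over the comonad induced by the adjunction between extension and restriction of scalars is an equivalence) if and only if $p$ is pure. -/

import Mathlib

open CategoryTheory Opposite

universe u

noncomputable section

/-- The indexed category of modules over the dual `CommRingCatᵒᵖ` of the category of commutative
rings: a commutative ring `B` is sent to the category of `B`-modules, and a ring homomorphism
`p : B → E` to the extension-of-scalars functor `E ⊗_B - : Mod_B ⥤ Mod_E`; the coherence
isomorphisms are the canonical ones. -/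
def modulesIndexedCategory :
    Pseudofunctor (LocallyDiscrete (CommRingCat.{u}ᵒᵖ)ᵒᵖ) Cat.{u, u + 1} :=
  LocallyDiscrete.mkPseudofunctor
    (fun R ↦ Cat.of (ModuleCat.{u} R.unop.unop))
    (fun f ↦ (ModuleCat.extendScalars f.unop.unop.hom).toCatHom)
    (fun R ↦ Cat.Hom.isoMk <| ModuleCat.extendScalarsId R.unop.unop)
    (fun f g ↦ Cat.Hom.isoMk <| ModuleCat.extendScalarsComp f.unop.unop.hom g.unop.unop.hom)
    (by intros; apply Cat.Hom₂.ext; apply ModuleCat.extendScalars_assoc')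
    (by intros; apply Cat.Hom₂.ext; apply ModuleCat.extendScalars_id_comp)
    (by intros; apply Cat.Hom₂.ext; apply ModuleCat.extendScalars_comp_id)

/-- A homomorphism `p : B → E` of commutative rings is an effective descent morphism for modules
if the canonical functor from `Mod_B` to the category of descent data relative to `p`
(for the indexed category of modules, `p` being regarded as a morphism `E ⟶ B` in the dual of
the category of commutative rings) is an equivalence of categories. -/
def IsEffectiveDescentForModules {B E : Type u} [CommRing B] [CommRing E] (p : B →+* E) : Prop :=
  (modulesIndexedCategory.{u}.toDescentData
    (fun _ : Unit ↦ (CommRingCat.ofHom p).op)).IsEquivalence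

/-- A functor is comonadic if it has a right adjoint for which the comparison functor to the
category of coalgebras over the induced comonad is an equivalence. -/
def IsComonadic {C D : Type*} [Category* C] [Category* D] (F : C ⥤ D) : Prop :=
  Nonempty (ComonadicLeftAdjoint F)

/-- A morphism `f : M → M'` of `B`-modules is pure if `N ⊗_B f : N ⊗_B M → N ⊗_B M'` is injective
for every `B`-module `N`. -/
def IsPureLinearMap {B M M' : Type u} [CommRing B] [AddCommGroup M] [Module B M]
    [AddCommGroup M'] [Module B M'] (f : M →ₗ[B] M') : Prop :=
  ∀ (N : Type u) [AddCommGroup N] [Module B N], Function.Injective (f.lTensor N)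

/-- A homomorphism `p : B → E` of commutative rings is pure if it is pure as a morphism of
`B`-modules, `E` being a `B`-module through `p`. -/
def IsPureRingHom {B E : Type u} [CommRing B] [CommRing E] (p : B →+* E) : Prop :=
  letI : Algebra B E := p.toAlgebra
  IsPureLinearMap (Algebra.linearMap B E)

end

/-!
Purity of `p : B → E` says that the unit `M → E ⊗_B M` of the adjunction between extension and
restriction of scalars is injective for all `M`, that is, that extension of scalars is faithful
(`isPureRingHom_iff_faithful`). Both comonadic and effective descent functors are faithful, because
`E ⊗_B -` factors through the functors that are then equivalences; so purity is necessary.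

Conversely, let `p` be pure and write `M⋆ = Hom_ℤ(M, ℚ/ℤ)`. Purity, applied to `B⋆`, splits the
restriction map `E⋆ → B⋆` (`IsPureLinearMap.exists_dual_section`), and as `(E ⊗ M)⋆ ≃ Hom(M, E⋆)`
this makes `(E ⊗ M)⋆ → M⋆` a split epimorphism, naturally in `M`. So if a pair `f, g : M ⇉ M'` has a
split equalizer after tensoring with `E`, the pair `f⋆, g⋆ : M'⋆ ⇉ M⋆` is contractible
(`exists_contraction_dual`). Contractibility survives `Hom(E, -)`, and characters detect
exactness, so `E ⊗_B -` preserves the equalizer of `f` and `g` (`IsPureRingHom.preservesLimit`).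
Beck's theorem then gives that the comparison functor to coalgebras is an equivalence.

To pass from coalgebras to descent data, a gluing morphism on `N` over `E ⊗_B E` is restricted along
`N → (E ⊗_B E) ⊗_E N` to a map `N → E ⊗_B N`. The unit and cocycle conditions turn into the
counit and coassociativity laws, and since the coaction determines all gluing morphisms, this is a
fully faithful functor from descent data to coalgebras (`ModuleDescentData.toCoalgebra`) whose
composite with the canonical functor is the comparison functor. If the comparison functor is an
equivalence, so is the canonical functor. Most computations take place on pure tensors, through the
maps `squareMap : T ⊗_R N → U ⊗_S N` for commutative squares of rings, which are bijective for
the universal square.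
-/

/-! ### Character modules -/

namespace CharacterModule

variable {B : Type*} [CommRing B] {M M' : Type*} [AddCommGroup M] [Module B M]
  [AddCommGroup M'] [Module B M']

/-- A character vanishing on the kernel of `h` factors through `h`. -/
lemma exists_dual_eq_of_ker_le (h : M →ₗ[B] M') (χ : CharacterModule M)
    (hχ : ∀ m, h m = 0 → χ m = 0) : ∃ ω : CharacterModule M', dual h ω = χ := by
  let j := (LinearMap.ker h).liftQ h le_rfl
  have hj : Function.Injective j :=
    LinearMap.ker_eq_bot.1 (Submodule.ker_liftQ_eq_bot _ _ _ le_rfl)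
  let χ' : CharacterModule (M ⧸ LinearMap.ker h) :=
    QuotientAddGroup.lift (LinearMap.ker h).toAddSubgroup χ (fun m hm ↦ hχ m hm)
  obtain ⟨ω, hω⟩ := dual_surjective_of_injective j hj χ'
  refine ⟨ω, CharacterModule.ext (A := M) fun m ↦ ?_⟩
  exact DFunLike.congr_fun hω (Submodule.Quotient.mk m)

/-- Characters separate a submodule from the elements outside it. -/
lemma mem_of_forall_character (K : Submodule B M) (x : M)
    (h : ∀ χ : CharacterModule M, (∀ k ∈ K, χ k = 0) → χ x = 0) : x ∈ K := by
  rw [← Submodule.Quotient.mk_eq_zero]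
  refine eq_zero_of_character_apply fun c ↦ ?_
  refine h (dual K.mkQ c) fun k hk ↦ ?_
  have : K.mkQ k = 0 := (Submodule.Quotient.mk_eq_zero K).2 hk
  change c (K.mkQ k) = 0
  rw [this, map_zero]

end CharacterModule

/-! ### Purity and character modules -/

section

open TensorProduct CharacterModule

variable {B E : Type u} [CommRing B] [CommRing E] [Algebra B E]

/-- If `B → E` is pure, the restriction map `E⋆ → B⋆` is a split epimorphism of `B`-modules: by
purity `B⋆ ⊗ B → B⋆ ⊗ E` is injective, so that the evaluation character of `B⋆ ⊗ B` extends. -/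
lemma IsPureLinearMap.exists_dual_section (h : IsPureLinearMap (Algebra.linearMap B E)) :
    ∃ s : CharacterModule B →ₗ[B] CharacterModule E,
      dual (Algebra.linearMap B E) ∘ₗ s = LinearMap.id := by
  obtain ⟨ω, hω⟩ := dual_surjective_of_injective _ (h (CharacterModule B)) (uncurry LinearMap.id)
  refine ⟨curry ω, ?_⟩
  ext χ b
  exact DFunLike.congr_fun hω (χ ⊗ₜ b)

variable {M M' : Type u} [AddCommGroup M] [Module B M] [AddCommGroup M'] [Module B M']

variable (M) in
/-- The map `M⋆ → (E ⊗ M)⋆` that a map `B⋆ → E⋆` induces through the identifications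
`M⋆ ≃ Hom(M, B⋆)` and `(E ⊗ M)⋆ ≃ Hom(M, E⋆)`. -/
noncomputable def extendCharacter (s : CharacterModule B →ₗ[B] CharacterModule E) :
    CharacterModule M →ₗ[B] CharacterModule (E ⊗[B] M) :=
  dual (TensorProduct.comm B E M).toLinearMap ∘ₗ uncurry ∘ₗ LinearMap.compRight B s ∘ₗ
    curry ∘ₗ dual (TensorProduct.rid B M).toLinearMap

variable (s : CharacterModule B →ₗ[B] CharacterModule E)

lemma extendCharacter_dual (f : M →ₗ[B] M') (χ : CharacterModule M') :
    extendCharacter M s (dual f χ) = dual (f.lTensor E) (extendCharacter M' s χ) := by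
  ext x
  induction x using TensorProduct.induction_on with
  | zero => simp only [map_zero]
  | add x y hx hy => rw [map_add, map_add, hx, hy]
  | tmul e m =>
    change s _ e = s _ e
    congr 2
    ext b
    change χ (f (b • m)) = χ (b • f m)
    rw [map_smul]

variable (E) in
lemma dual_mk_dual_lTensor (f : M →ₗ[B] M') (ψ : CharacterModule (E ⊗[B] M')) :
    dual (TensorProduct.mk B E M 1) (dual (f.lTensor E) ψ) =
      dual f (dual (TensorProduct.mk B E M' 1) ψ) :=
  rfl

lemma dual_mk_extendCharacter (hs : dual (Algebra.linearMap B E) ∘ₗ s = LinearMap.id)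
    (χ : CharacterModule M) : dual (TensorProduct.mk B E M 1) (extendCharacter M s χ) = χ := by
  ext m
  have := DFunLike.congr_fun (LinearMap.congr_fun hs (dual (LinearMap.toSpanSingleton B M m) χ)) 1
  change s _ (algebraMap B E 1) = χ ((1 : B) • m) at this
  rw [map_one, one_smul] at this
  exact this

/-- A pair `f`, `g` that becomes contractible after tensoring with `E` has a contractible pair of
character modules, as soon as `E⋆ → B⋆` has a section. -/
lemma exists_contraction_dual (hs : dual (Algebra.linearMap B E) ∘ₗ s = LinearMap.id)
    {f g : M →ₗ[B] M'} (t : E ⊗[B] M' →ₗ[B] E ⊗[B] M)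
    (hg : t ∘ₗ g.lTensor E = LinearMap.id)
    (hf : f.lTensor E ∘ₗ t ∘ₗ f.lTensor E = g.lTensor E ∘ₗ t ∘ₗ f.lTensor E) :
    ∃ T : CharacterModule M →ₗ[B] CharacterModule M',
      (∀ χ, dual g (T χ) = χ) ∧ ∀ ω, dual f (T (dual f ω)) = dual f (T (dual g ω)) := by
  refine ⟨dual (TensorProduct.mk B E M' 1) ∘ₗ dual t ∘ₗ extendCharacter M s,
    fun χ ↦ ?_, fun ω ↦ ?_⟩
  · simp only [LinearMap.comp_apply]
    have key (φ : CharacterModule (E ⊗[B] M)) : dual (g.lTensor E) (dual t φ) = φ := by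
      ext x
      exact congrArg φ (LinearMap.congr_fun hg x)
    rw [← dual_mk_dual_lTensor, key, dual_mk_extendCharacter s hs]
  · simp only [LinearMap.comp_apply]
    have key (φ : CharacterModule (E ⊗[B] M')) :
        dual (f.lTensor E) (dual t (dual (f.lTensor E) φ)) =
          dual (f.lTensor E) (dual t (dual (g.lTensor E) φ)) := by
      ext x
      exact congrArg φ (LinearMap.congr_fun hf x)
    rw [← dual_mk_dual_lTensor, ← dual_mk_dual_lTensor, extendCharacter_dual, extendCharacter_dual,
      key]

/-- Tensoring with `E` preserves the equalizer of a pair whose character modules are contractible: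
exactness part. -/
lemma mem_range_lTensor_of_contraction_dual {f g : M →ₗ[B] M'}
    (T : CharacterModule M →ₗ[B] CharacterModule M') (hg : ∀ χ, dual g (T χ) = χ)
    (hf : ∀ ω, dual f (T (dual f ω)) = dual f (T (dual g ω)))
    (x : E ⊗[B] M) (hx : f.lTensor E x = g.lTensor E x) :
    x ∈ LinearMap.range ((LinearMap.ker (f - g)).subtype.lTensor E) := by
  refine mem_of_forall_character _ _ fun ψ hψ ↦ ?_
  obtain ⟨Ψ, rfl⟩ := homEquiv.surjective ψ
  -- `Ψ : E → M⋆` takes values in the characters that vanish on the equalizer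
  have h0 (e : E) : dual f (T (Ψ e)) = 0 := by
    obtain ⟨ω, hω⟩ := exists_dual_eq_of_ker_le (f - g) (Ψ e)
      fun m hm ↦ hψ (e ⊗ₜ m) ⟨e ⊗ₜ ⟨m, hm⟩, rfl⟩
    have h1 : dual (f - g) ω = dual f ω - dual g ω := by
      ext m
      exact map_sub ω _ _
    rw [← hω, h1, map_sub, map_sub, hf, sub_self]
  have h1 : dual (f.lTensor E) (homEquiv (T ∘ₗ Ψ)) = 0 := by
    ext y
    induction y using TensorProduct.induction_on with
    | zero => simp only [map_zero]
    | add x y hx hy => rw [map_add, map_add, hx, hy]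
    | tmul e m => exact DFunLike.congr_fun (h0 e) m
  have h2 : dual (g.lTensor E) (homEquiv (T ∘ₗ Ψ)) = homEquiv Ψ := by
    ext y
    induction y using TensorProduct.induction_on with
    | zero => simp only [map_zero]
    | add x y hx hy => rw [map_add, map_add, hx, hy]
    | tmul e m => exact DFunLike.congr_fun (hg (Ψ e)) m
  rw [← h2]
  change homEquiv (T ∘ₗ Ψ) (g.lTensor E x) = 0
  rw [← hx]
  exact DFunLike.congr_fun h1 x

/-- Tensoring with `E` preserves the equalizer of a pair whose character modules are contractible:
injectivity part. -/
lemma lTensor_injective_of_contraction_dual {f g : M →ₗ[B] M'}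
    (T : CharacterModule M →ₗ[B] CharacterModule M') (hg : ∀ χ, dual g (T χ) = χ)
    (hf : ∀ ω, dual f (T (dual f ω)) = dual f (T (dual g ω))) :
    Function.Injective ((LinearMap.ker (f - g)).subtype.lTensor E) := by
  let i := (LinearMap.ker (f - g)).subtype
  have hi : Function.Surjective (dual i) :=
    dual_surjective_of_injective i (Submodule.injective_subtype _)
  have hfg (χ : CharacterModule M') : dual i (dual f χ) = dual i (dual g χ) := by
    ext k
    have : f k = g k := sub_eq_zero.1 k.2
    exact congrArg χ this
  -- `f⋆ T` vanishes on the kernel of `i⋆`, so it induces a section of `i⋆`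
  have hker : LinearMap.ker (dual i) ≤ LinearMap.ker (dual f ∘ₗ T) := by
    intro χ hχ
    obtain ⟨ω, rfl⟩ := exists_dual_eq_of_ker_le (f - g) χ
      fun m hm ↦ DFunLike.congr_fun (LinearMap.mem_ker.1 hχ) (⟨m, hm⟩ : LinearMap.ker (f - g))
    have h1 : dual (f - g) ω = dual f ω - dual g ω := by
      ext m
      exact map_sub ω _ _
    rw [LinearMap.mem_ker, LinearMap.comp_apply, h1, map_sub, map_sub, hf, sub_self]
  let u := (LinearMap.ker (dual i)).liftQ _ hker ∘ₗ
    ((dual i).quotKerEquivOfSurjective hi).symm.toLinearMap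
  have hu (χ : CharacterModule M) : u (dual i χ) = dual f (T χ) := by
    have : ((dual i).quotKerEquivOfSurjective hi).symm (dual i χ) = Submodule.Quotient.mk χ := by
      rw [LinearEquiv.symm_apply_eq]
      rfl
    simp only [u, LinearMap.comp_apply, LinearEquiv.coe_coe, this]
    rfl
  have hiu (κ : CharacterModule (LinearMap.ker (f - g))) : dual i (u κ) = κ := by
    obtain ⟨χ, rfl⟩ := hi κ
    rw [hu, hfg, hg]
  refine (injective_iff_map_eq_zero _).2 fun y hy ↦ eq_zero_of_character_apply fun c ↦ ?_
  obtain ⟨Ψ, rfl⟩ := homEquiv.surjective c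
  have h : dual (i.lTensor E) (homEquiv (u ∘ₗ Ψ)) = homEquiv Ψ := by
    ext y
    induction y using TensorProduct.induction_on with
    | zero => simp only [map_zero]
    | add x y hx hy => rw [map_add, map_add, hx, hy]
    | tmul e m => exact DFunLike.congr_fun (hiu (Ψ e)) m
  rw [← h]
  change homEquiv (u ∘ₗ Ψ) (i.lTensor E y) = 0
  rw [hy, map_zero]

end

/-! ### Purity and comonadicity -/

section

open TensorProduct Limits

section

variable {B E : Type u} [CommRing B] [CommRing E] (p : B →+* E)

/-- Up to the symmetry of the tensor product, `M ⊗ p` is the unit of the adjunction at `M`, and a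
left adjoint is faithful exactly if its unit is a monomorphism. -/
lemma isPureRingHom_iff_faithful :
    IsPureRingHom p ↔ (ModuleCat.extendScalars.{u, u, u} p).Faithful := by
  let : Algebra B E := p.toAlgebra
  have key (M : ModuleCat.{u} B) :
      Mono ((ModuleCat.extendRestrictScalarsAdj.{u} p).unit.app M) ↔
        Function.Injective ((Algebra.linearMap B E).lTensor M) := by
    rw [ModuleCat.mono_iff_injective]
    change Function.Injective (fun m : M ↦ (1 : E) ⊗ₜ[B] m) ↔ _
    have h : (fun m : M ↦ (1 : E) ⊗ₜ[B] m) =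
        TensorProduct.comm B M E ∘ (Algebra.linearMap B E).lTensor M ∘
          (TensorProduct.rid B M).symm := by
      ext m
      change (1 : E) ⊗ₜ[B] m = algebraMap B E 1 ⊗ₜ[B] m
      rw [map_one]
    rw [h, EquivLike.comp_injective, EquivLike.injective_comp]
  constructor
  · intro h
    have (M : ModuleCat.{u} B) : Mono ((ModuleCat.extendRestrictScalarsAdj.{u} p).unit.app M) :=
      (key M).2 (h M)
    exact (ModuleCat.extendRestrictScalarsAdj.{u} p).faithful_L_of_mono_unit_app
  · intro h N _ _
    exact (key (ModuleCat.of B N)).1 inferInstance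

lemma IsComonadic.faithful {C D : Type*} [Category* C] [Category* D] {F : C ⥤ D}
    (h : IsComonadic F) : F.Faithful := by
  obtain ⟨h⟩ := h
  exact inferInstanceAs
    (Comonad.comparison (comonadicAdjunction F) ⋙ Comonad.forget _).Faithful

/-- A fork of modules is limiting if its map is injective with image the whole equalizer. -/
lemma ModuleCat.nonempty_isLimit_fork {R : Type u} [Ring R] {X Y : ModuleCat.{u} R} {f g : X ⟶ Y}
    (c : Fork f g) (hinj : Function.Injective c.ι)
    (h : ∀ x, f x = g x → ∃ k, c.ι k = x) : Nonempty (IsLimit c) := by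
  have := (ModuleCat.mono_iff_injective _).2 hinj
  refine ⟨Fork.IsLimit.mk' c fun s ↦ ?_⟩
  let e := LinearEquiv.ofInjective c.ι.hom hinj
  have hs (y : s.pt) : s.ι y ∈ LinearMap.range c.ι.hom :=
    h _ (ConcreteCategory.congr_hom s.condition y)
  refine ⟨ModuleCat.ofHom (e.symm.toLinearMap ∘ₗ s.ι.hom.codRestrict _ hs), ?_, fun {m} hm ↦ ?_⟩
  · ext y
    exact congrArg Subtype.val (e.apply_symm_apply ⟨s.ι y, hs y⟩)
  · rw [← cancel_mono c.ι, hm]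
    ext y
    exact (congrArg Subtype.val (e.apply_symm_apply ⟨s.ι y, hs y⟩)).symm

end

section

variable {B E : Type u} [CommRing B] [CommRing E] {p : B →+* E}

/-- If `p` is pure, extension of scalars preserves the equalizers of the pairs that acquire a split
equalizer in `Mod_E`. -/
lemma IsPureRingHom.preservesLimit (h : IsPureRingHom p) {M M' : ModuleCat.{u} B} (f g : M ⟶ M')
    [(ModuleCat.extendScalars.{u, u, u} p).IsCosplitPair f g] :
    PreservesLimit (parallelPair f g) (ModuleCat.extendScalars.{u, u, u} p) := by
  let : Algebra B E := p.toAlgebra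
  let F := ModuleCat.extendScalars.{u, u, u} p
  let G := ModuleCat.restrictScalars.{u, u, u} p
  have hW := HasSplitEqualizer.isSplitEqualizer (F.map f) (F.map g)
  let t : E ⊗[B] M' →ₗ[B] E ⊗[B] M := (G.map hW.rightRetraction).hom
  have hg : t ∘ₗ g.hom.lTensor E = LinearMap.id := by
    refine LinearMap.ext fun x ↦ ?_
    exact ConcreteCategory.congr_hom hW.bottom_rightRetraction x
  have hf : f.hom.lTensor E ∘ₗ t ∘ₗ f.hom.lTensor E =
      g.hom.lTensor E ∘ₗ t ∘ₗ f.hom.lTensor E := by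
    have h1 : F.map f ≫ hW.rightRetraction ≫ F.map f =
        F.map f ≫ hW.rightRetraction ≫ F.map g := by
      rw [hW.top_rightRetraction_assoc, hW.top_rightRetraction_assoc, hW.condition]
    refine LinearMap.ext fun x ↦ ?_
    exact ConcreteCategory.congr_hom h1 x
  obtain ⟨s, hs⟩ := IsPureLinearMap.exists_dual_section h
  obtain ⟨T, hTg, hTf⟩ := exists_contraction_dual s hs t hg hf
  let c : Fork f g := Fork.ofι (ModuleCat.ofHom (LinearMap.ker (f.hom - g.hom)).subtype) (by
    ext k
    exact sub_eq_zero.1 k.2)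
  have hc : IsLimit c := (ModuleCat.nonempty_isLimit_fork c (Submodule.injective_subtype _)
    fun x hx ↦ ⟨⟨x, sub_eq_zero.2 hx⟩, rfl⟩).some
  refine preservesLimit_of_preserves_limit_cone hc ?_
  refine (isLimitMapConeForkEquiv F c.condition).symm ?_
  have hinj := lTensor_injective_of_contraction_dual (E := E) T hTg hTf
  have hrange := mem_range_lTensor_of_contraction_dual (E := E) T hTg hTf
  refine (ModuleCat.nonempty_isLimit_fork _ ?_ ?_).some
  · exact hinj
  · exact hrange

/-- Beck's comonadicity theorem for pure `p`: extension of scalars reflects isomorphisms, being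
faithful on an abelian category, and preserves the relevant equalizers. -/
lemma IsPureRingHom.isEquivalence_comparison (h : IsPureRingHom p) :
    (Comonad.comparison (ModuleCat.extendRestrictScalarsAdj.{u} p)).IsEquivalence := by
  have := (isPureRingHom_iff_faithful p).1 h
  have : Comonad.HasEqualizerOfIsCosplitPair (ModuleCat.extendScalars.{u, u, u} p) :=
    ⟨fun _ _ _ ↦ inferInstance⟩
  have : Comonad.PreservesLimitOfIsCosplitPair (ModuleCat.extendScalars.{u, u, u} p) :=
    ⟨fun f g _ ↦ h.preservesLimit f g⟩
  exact (Comonad.comonadicOfHasPreservesFSplitEqualizersOfReflectsIsomorphisms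
    (ModuleCat.extendRestrictScalarsAdj.{u} p)).eqv

lemma isComonadic_iff_isPureRingHom :
    IsComonadic (ModuleCat.extendScalars.{u, u, u} p) ↔ IsPureRingHom p :=
  ⟨fun h ↦ (isPureRingHom_iff_faithful p).2 h.faithful,
    fun h ↦ ⟨{ R := _, adj := _, eqv := h.isEquivalence_comparison }⟩⟩

end

end

/-! ### Extension of scalars in terms of pure tensors -/

namespace ModuleCat.ExtendScalars

open scoped TensorProduct

variable {R S T : Type u} [CommRing R] [CommRing S] [CommRing T] (f : R →+* S)

/-- The pure tensor `s ⊗ m` in the extension of scalars of `M` along `f`. -/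
noncomputable def tmul {M : ModuleCat.{u} R} (s : S) (m : M) : (extendScalars.{u, u, u} f).obj M :=
  letI := f.toAlgebra
  (s ⊗ₜ[R] m : S ⊗[R] M)

section

variable {M M' : ModuleCat.{u} R}

lemma add_tmul (s s' : S) (m : M) : tmul f (s + s') m = tmul f s m + tmul f s' m :=
  let := f.toAlgebra
  TensorProduct.add_tmul s s' m

lemma tmul_add (s : S) (m m' : M) : tmul f s (m + m') = tmul f s m + tmul f s m' :=
  let := f.toAlgebra
  TensorProduct.tmul_add s m m'

lemma smul_tmul_eq (s s' : S) (m : M) : s • tmul f s' m = tmul f (s * s') m := rfl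

lemma tmul_smul (s : S) (r : R) (m : M) : tmul f s (r • m) = tmul f (s * f r) m := by
  let := f.toAlgebra
  change (s ⊗ₜ[R] (r • m) : S ⊗[R] M) = (s * f r) ⊗ₜ[R] m
  rw [← TensorProduct.smul_tmul, mul_comm]
  rfl

variable {f} in
lemma induction {P : (extendScalars.{u, u, u} f).obj M → Prop} (zero : P 0)
    (tmul : ∀ s m, P (tmul f s m)) (add : ∀ x y, P x → P y → P (x + y)) (x) : P x :=
  let := f.toAlgebra
  TensorProduct.induction_on (motive := P) x zero tmul add

/-- Additive maps out of an extension of scalars, from balanced biadditive maps. -/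
noncomputable def liftAddHom {P : Type*} [AddCommGroup P] (φ : S →+ M →+ P)
    (hφ : ∀ s r m, φ (s * f r) m = φ s (r • m)) : (extendScalars.{u, u, u} f).obj M →+ P :=
  letI := f.toAlgebra
  TensorProduct.liftAddHom (R := R) (M := S) (N := M) φ (fun r s m ↦ by
    rw [← hφ, mul_comm]; rfl)

end

lemma zero_tmul {M : ModuleCat.{u} R} (m : M) : tmul f 0 m = 0 :=
  let := f.toAlgebra
  TensorProduct.zero_tmul S m

lemma tmul_zero {M : ModuleCat.{u} R} (s : S) : tmul f s (0 : M) = 0 :=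
  let := f.toAlgebra
  TensorProduct.tmul_zero M s

/-- The biadditive map `(s, m) ↦ s ⊗ m`. -/
noncomputable def tmulHom (M : ModuleCat.{u} R) : S →+ M →+ (extendScalars.{u, u, u} f).obj M :=
  AddMonoidHom.mk' (fun s ↦ AddMonoidHom.mk' (tmul f s) (tmul_add f s))
    (fun s s' ↦ by ext m; exact add_tmul f s s' m)

/-- For `h = g ∘ f`, the map `S ⊗ M → T ⊗ M` sending `s ⊗ m` to `g s ⊗ m`. -/
noncomputable def baseChange (g : S →+* T) (h : R →+* T) (hgf : g.comp f = h)
    (M : ModuleCat.{u} R) :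
    (extendScalars.{u, u, u} f).obj M →+ (extendScalars.{u, u, u} h).obj M :=
  liftAddHom f ((tmulHom h M).comp g.toAddMonoidHom) (fun s r m ↦ by
    subst hgf
    change tmul _ (g (s * f r)) m = tmul _ (g s) (r • m)
    rw [tmul_smul, map_mul]
    rfl)

lemma baseChange_tmul (g : S →+* T) (h : R →+* T) (hgf : g.comp f = h) (M : ModuleCat.{u} R)
    (s : S) (m : M) : baseChange f g h hgf M (tmul f s m) = tmul h (g s) m := rfl

section

variable {U : Type u} [CommRing U] (q : R →+* T) (f₁ : T →+* U) (f₂ : S →+* U)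
  (h : f₁.comp q = f₂.comp f)

/-- For a commutative square `f₁ ∘ q = f₂ ∘ f` of rings and an `S`-module `N`, the base change map
`T ⊗_R N → U ⊗_S N` sending `t ⊗ n` to `f₁ t ⊗ n`. -/
noncomputable def squareMap (N : ModuleCat.{u} S) :
    (extendScalars.{u, u, u} q).obj ((restrictScalars.{u, u, u} f).obj N) →+
      (extendScalars.{u, u, u} f₂).obj N :=
  liftAddHom q (M := (restrictScalars.{u, u, u} f).obj N)
    ((tmulHom f₂ N).comp f₁.toAddMonoidHom) (fun s r m ↦ by
      have key (n : N) : tmul f₂ (f₁ (s * q r)) n = tmul f₂ (f₁ s) (f r • n) := by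
        rw [tmul_smul, map_mul]
        exact congrArg (fun t ↦ tmul f₂ (f₁ s * t) n) (RingHom.congr_fun h r)
      exact key m)

lemma squareMap_tmul (N : ModuleCat.{u} S) (t : T) (n : N) :
    squareMap f q f₁ f₂ h N (tmul q (M := (restrictScalars.{u, u, u} f).obj N) t n) =
      tmul f₂ (f₁ t) n := rfl

lemma squareMap_smul (N : ModuleCat.{u} S) (t : T)
    (x : (extendScalars.{u, u, u} q).obj ((restrictScalars.{u, u, u} f).obj N)) :
    squareMap f q f₁ f₂ h N (t • x) = f₁ t • squareMap f q f₁ f₂ h N x := by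
  induction x using ExtendScalars.induction with
  | zero => simp only [smul_zero, map_zero]
  | add x y hx hy => rw [smul_add, map_add, map_add, hx, hy, smul_add]
  | tmul t' n =>
    rw [smul_tmul_eq]
    have key (n : N) : tmul f₂ (f₁ (t * t')) n = f₁ t • tmul f₂ (f₁ t') n := by
      rw [smul_tmul_eq, map_mul]
    exact key n

lemma squareMap_map {N N' : ModuleCat.{u} S} (φ : N ⟶ N')
    (x : (extendScalars.{u, u, u} q).obj ((restrictScalars.{u, u, u} f).obj N)) :
    squareMap f q f₁ f₂ h N'
        ((extendScalars.{u, u, u} q).map ((restrictScalars.{u, u, u} f).map φ) x) =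
      (extendScalars.{u, u, u} f₂).map φ (squareMap f q f₁ f₂ h N x) := by
  induction x using ExtendScalars.induction with
  | zero => simp only [map_zero]
  | add x y hx hy => simp only [map_add, hx, hy]
  | tmul s n => rfl

end

section

variable (q : R →+* T)

/-- The tensor product `T ⊗_R S` for ring homomorphisms `f : R → S` and `q : R → T`. -/
def Pushout : Type u :=
  letI := f.toAlgebra
  letI := q.toAlgebra
  T ⊗[R] S

namespace Pushout

noncomputable instance : CommRing (Pushout f q) :=
  @Algebra.TensorProduct.instCommRing R T S _ _ q.toAlgebra _ f.toAlgebra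

/-- The ring homomorphism `t ↦ t ⊗ 1`. -/
noncomputable def inl : T →+* Pushout f q :=
  letI := f.toAlgebra
  letI := q.toAlgebra
  (Algebra.TensorProduct.includeLeftRingHom : T →+* T ⊗[R] S)

/-- The ring homomorphism `s ↦ 1 ⊗ s`. -/
noncomputable def inr : S →+* Pushout f q :=
  letI := f.toAlgebra
  letI := q.toAlgebra
  (Algebra.TensorProduct.includeRight : S →ₐ[R] T ⊗[R] S).toRingHom

lemma inl_comp : (inl f q).comp q = (inr f q).comp f := by
  let := f.toAlgebra
  let := q.toAlgebra
  ext r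
  exact ((Algebra.TensorProduct.includeRight : S →ₐ[R] T ⊗[R] S).commutes r).symm

lemma exists_lift {U : Type u} [CommRing U] (f₁ : T →+* U) (f₂ : S →+* U)
    (h : f₁.comp q = f₂.comp f) :
    ∃ g : Pushout f q →+* U, g.comp (inl f q) = f₁ ∧ g.comp (inr f q) = f₂ := by
  let := f.toAlgebra
  let := q.toAlgebra
  let := (f₁.comp q).toAlgebra
  let g₁ : T →ₐ[R] U := { f₁ with commutes' := fun _ ↦ rfl }
  let g₂ : S →ₐ[R] U := { f₂ with commutes' := fun r ↦ (RingHom.congr_fun h r).symm }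
  refine ⟨(Algebra.TensorProduct.productMap g₁ g₂).toRingHom, ?_, ?_⟩
  · ext t
    exact Algebra.TensorProduct.productMap_left_apply g₁ g₂ t
  · ext s
    exact Algebra.TensorProduct.productMap_right_apply g₁ g₂ s

lemma inl_mul_inr (t : T) (s : S) : inl f q t * inr f q s =
    letI := f.toAlgebra
    letI := q.toAlgebra
    (t ⊗ₜ[R] s : T ⊗[R] S) := by
  let := f.toAlgebra
  let := q.toAlgebra
  refine (Algebra.TensorProduct.tmul_mul_tmul t 1 1 s).trans ?_
  rw [mul_one, one_mul]

variable {f q} in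
lemma induction {P : Pushout f q → Prop} (zero : P 0) (mul : ∀ t s, P (inl f q t * inr f q s))
    (add : ∀ x y, P x → P y → P (x + y)) (x) : P x :=
  let := f.toAlgebra
  let := q.toAlgebra
  TensorProduct.induction_on (motive := P) x zero
    (fun t s ↦ by rw [← inl_mul_inr]; exact mul t s) add

/-- Additive maps out of `T ⊗_R S`, from balanced biadditive maps. -/
noncomputable def liftAddHom {P : Type*} [AddCommGroup P] (φ : T →+ S →+ P)
    (hφ : ∀ t r s, φ (t * q r) s = φ t (f r * s)) : Pushout f q →+ P :=
  letI := f.toAlgebra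
  letI := q.toAlgebra
  TensorProduct.liftAddHom (R := R) (M := T) (N := S) φ (fun r t s ↦ by
    refine Eq.trans ?_ (hφ t r s)
    rw [mul_comm]; rfl)

lemma liftAddHom_inl_mul_inr {P : Type*} [AddCommGroup P] (φ : T →+ S →+ P)
    (hφ : ∀ t r s, φ (t * q r) s = φ t (f r * s)) (t : T) (s : S) :
    liftAddHom f q φ hφ (inl f q t * inr f q s) = φ t s := by
  rw [inl_mul_inr]
  rfl

/-- For the universal commutative square, the base change map `T ⊗_R N → (T ⊗_R S) ⊗_S N` is
bijective. -/
lemma squareMap_bijective (N : ModuleCat.{u} S) :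
    Function.Bijective (squareMap f q (inl f q) (inr f q) (inl_comp f q) N) := by
  let N₀ := (restrictScalars.{u, u, u} f).obj N
  let φ : Pushout f q →+ N →+ (extendScalars.{u, u, u} q).obj N₀ :=
    liftAddHom f q
      (AddMonoidHom.mk'
        (fun t ↦ (AddMonoidHom.compHom (tmulHom q N₀ t : N →+ _)).comp (smulAddHom S N))
        (fun t t' ↦ by ext s n; exact ExtendScalars.add_tmul q t t' (M := N₀) _))
      (fun t r s ↦ by
        ext n
        refine (ExtendScalars.tmul_smul q t r (M := N₀) (s • n : N)).symm.trans ?_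
        exact congrArg (tmul q t (M := N₀)) (mul_smul (f r) s n).symm)
  have hφ (t : T) (s : S) (n : N) :
      φ (inl f q t * inr f q s) n = tmul q t (M := N₀) (s • n : N) :=
    DFunLike.congr_fun (liftAddHom_inl_mul_inr f q _ _ t s) n
  let ρ : (extendScalars.{u, u, u} (inr f q)).obj N →+ (extendScalars.{u, u, u} q).obj N₀ :=
    ExtendScalars.liftAddHom (M := N) (inr f q) φ (fun z s n ↦ by
      induction z using Pushout.induction with
      | zero => rw [zero_mul, map_zero]; rfl
      | add z z' hz hz' => rw [add_mul, map_add, map_add]; exact congrArg₂ (· + ·) hz hz'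
      | mul t s' => rw [mul_assoc, ← map_mul, hφ, hφ, mul_smul])
  have hρ (z : Pushout f q) (n : N) : ρ (tmul (inr f q) z n) = φ z n := rfl
  refine Function.bijective_iff_has_inverse.2 ⟨fun x ↦ ρ x, fun x ↦ ?_, fun x ↦ ?_⟩
  · dsimp only
    induction x using ExtendScalars.induction with
    | zero => simp only [map_zero]
    | add x y hx hy => simp only [map_add, hx, hy]
    | tmul t n =>
      refine (hρ (inl f q t) n).trans ?_
      rw [← mul_one (inl f q t), ← map_one (inr f q)]
      exact (hφ t 1 n).trans (congrArg (tmul q t (M := N₀)) (one_smul S (n : N)))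
  · dsimp only
    induction x using ExtendScalars.induction with
    | zero => simp only [map_zero]
    | add x y hx hy => simp only [map_add, hx, hy]
    | tmul z n =>
      induction z using Pushout.induction with
      | zero => rw [ExtendScalars.zero_tmul, map_zero, map_zero]
      | add z z' hz hz' => rw [ExtendScalars.add_tmul, map_add, map_add, hz, hz']
      | mul t s =>
        rw [hρ, hφ]
        exact ExtendScalars.tmul_smul (inr f q) (inl f q t) s n

end Pushout

end

end ModuleCat.ExtendScalars

/-! ### The coherence isomorphisms of the indexed category of modules -/

section

open ModuleCat ExtendScalars

lemma extendScalarsComp_hom_app_tmul {R S T : Type u} [CommRing R] [CommRing S] [CommRing T]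
    (f : R →+* S) (g : S →+* T) (M : ModuleCat.{u} R) (t : T) (m : M) :
    (extendScalarsComp f g).hom.app M (tmul (g.comp f) t m) = tmul g t (tmul f 1 m) := by
  have h : tmul (g.comp f) t m = t • tmul (g.comp f) 1 m := by rw [smul_tmul_eq, mul_one]
  rw [h, map_smul]
  refine (congrArg (t • ·) (extendScalarsComp_hom_app_one_tmul f g M m)).trans ?_
  refine (smul_tmul_eq g t 1 (tmul f 1 m)).trans ?_
  rw [mul_one]

/-- The component at `M` of the coherence isomorphism of a pseudofunctor for a composition. -/
def CategoryTheory.Pseudofunctor.mapComp'App {C : Type*} [Category* C]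
    (F : Pseudofunctor (LocallyDiscrete Cᵒᵖ) Cat) {X Y Z : C} (f : Y ⟶ X) (g : Z ⟶ Y) (fg : Z ⟶ X)
    (h : g ≫ f = fg) (M : F.obj (.mk (op X))) :
    (F.map fg.op.toLoc).toFunctor.obj M ≅
      (F.map g.op.toLoc).toFunctor.obj ((F.map f.op.toLoc).toFunctor.obj M) :=
  (Cat.Hom.toNatIso (F.mapComp' f.op.toLoc g.op.toLoc fg.op.toLoc (by rw [← h]; rfl))).app M

lemma CategoryTheory.Pseudofunctor.toDescentData_obj_hom {C : Type*} [Category* C]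
    (F : Pseudofunctor (LocallyDiscrete Cᵒᵖ) Cat) {ι : Type*} {S : C} {X : ι → C} (f : ∀ i, X i ⟶ S)
    (M : F.obj (.mk (op S))) {Y : C} (q : Y ⟶ S) {i₁ i₂ : ι} (f₁ : Y ⟶ X i₁) (f₂ : Y ⟶ X i₂)
    (h₁ : f₁ ≫ f i₁ = q) (h₂ : f₂ ≫ f i₂ = q) :
    ((F.toDescentData f).obj M).hom q f₁ f₂ h₁ h₂ =
      (F.mapComp'App (f i₁) f₁ q h₁ M).inv ≫ (F.mapComp'App (f i₂) f₂ q h₂ M).hom :=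
  rfl

section

variable {R S T : Type u} [CommRing R] [CommRing S] [CommRing T] (f : R →+* S) (g : S →+* T)
  (fg : R →+* T) (h : g.comp f = fg) (M : ModuleCat.{u} R)

/-- The coherence isomorphism of the indexed category of modules for a composition. -/
noncomputable def modulesIndexedCategoryComp : (extendScalars.{u, u, u} fg).obj M ≅
    (extendScalars.{u, u, u} g).obj ((extendScalars.{u, u, u} f).obj M) :=
  modulesIndexedCategory.{u}.mapComp'App (CommRingCat.ofHom f).op (CommRingCat.ofHom g).op
    (CommRingCat.ofHom fg).op (by rw [← h]; rfl) M

lemma modulesIndexedCategoryComp_hom_tmul (t : T) (m : M) :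
    (modulesIndexedCategoryComp f g fg h M).hom (tmul fg t m) = tmul g t (tmul f 1 m) := by
  subst h
  unfold modulesIndexedCategoryComp Pseudofunctor.mapComp'App
  have := modulesIndexedCategory.{u}.mapComp'_eq_mapComp (CommRingCat.ofHom f).op.op.toLoc
    (CommRingCat.ofHom g).op.op.toLoc
  erw [this]
  exact extendScalarsComp_hom_app_tmul f g M t m

lemma modulesIndexedCategoryComp_hom_baseChange (x : (extendScalars.{u, u, u} f).obj M) :
    (modulesIndexedCategoryComp f g fg h M).hom (baseChange f g fg h M x) = tmul g 1 x := by
  induction x using ExtendScalars.induction with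
  | zero => rw [map_zero, map_zero, ExtendScalars.tmul_zero]
  | add x y hx hy => rw [map_add, map_add, hx, hy, ExtendScalars.tmul_add]
  | tmul s m =>
    rw [baseChange_tmul, modulesIndexedCategoryComp_hom_tmul, ← one_mul (g s)]
    refine (ExtendScalars.tmul_smul g 1 s (tmul f 1 m)).symm.trans ?_
    rw [smul_tmul_eq, mul_one]

end

lemma ModuleCat.inv_comp_apply {R : Type*} [Ring R] {N N' N'' : ModuleCat.{u} R} (e : N ≅ N')
    (φ : N ⟶ N'') {x : N} {y : N'} {z : N''} (hy : e.hom x = y) (hz : φ x = z) :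
    (e.inv ≫ φ) y = z := by
  rw [← hy, ConcreteCategory.comp_apply, Iso.hom_inv_id_apply, hz]

section

variable {R S T : Type u} [CommRing R] [CommRing S] [CommRing T] (f : R →+* S) (g g' : S →+* T)
  (fg : R →+* T) (h : g.comp f = fg) (h' : g'.comp f = fg) (M : ModuleCat.{u} R)

/-- The canonical morphism `g^* f^* M → g'^* f^* M` for `g ∘ f = fg = g' ∘ f`. -/
noncomputable def canonicalGluing :
    (extendScalars.{u, u, u} g).obj ((extendScalars.{u, u, u} f).obj M) ⟶
      (extendScalars.{u, u, u} g').obj ((extendScalars.{u, u, u} f).obj M) :=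
  (modulesIndexedCategoryComp f g fg h M).inv ≫ (modulesIndexedCategoryComp f g' fg h' M).hom

lemma canonicalGluing_tmul (t : T) (m : M) :
    canonicalGluing f g g' fg h h' M (tmul g t (tmul f 1 m)) = tmul g' t (tmul f 1 m) :=
  ModuleCat.inv_comp_apply _ _ (modulesIndexedCategoryComp_hom_tmul f g fg h M t m)
    (modulesIndexedCategoryComp_hom_tmul f g' fg h' M t m)

end

end

/-! ### The two- and threefold tensor products -/

namespace ModuleCat.ExtendScalars

section

variable {R S T : Type u} [CommRing R] [CommRing S] [CommRing T] (f : R →+* S)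

lemma baseChange_squareMap {U V : Type u} [CommRing U] [CommRing V] (q : R →+* T) (f₁ : T →+* U)
    (f₂ : S →+* U) (h : f₁.comp q = f₂.comp f) (g : U →+* V) (N : ModuleCat.{u} S)
    (x : (extendScalars.{u, u, u} q).obj ((restrictScalars.{u, u, u} f).obj N)) :
    baseChange f₂ g (g.comp f₂) rfl N (squareMap f q f₁ f₂ h N x) =
      squareMap f q (g.comp f₁) (g.comp f₂) (by rw [RingHom.comp_assoc, h, RingHom.comp_assoc])
        N x := by
  induction x using ExtendScalars.induction with
  | zero => simp only [map_zero]
  | add x y hx hy => simp only [map_add, hx, hy]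
  | tmul t n => rfl

lemma extendScalarsComp_inv_app_tmul_tmul (g : S →+* T) (M : ModuleCat.{u} R) (t : T) (s : S)
    (m : M) :
    (extendScalarsComp f g).inv.app M (tmul g t (tmul f s m)) = tmul (g.comp f) (t * g s) m := by
  have h : tmul g t (tmul f s m) =
      ((extendScalarsComp f g).app M).hom (tmul (g.comp f) (t * g s) m) := by
    refine Eq.trans ?_ (extendScalarsComp_hom_app_tmul f g M (t * g s) m).symm
    rw [← ExtendScalars.tmul_smul, smul_tmul_eq, mul_one]
  rw [h]
  exact ConcreteCategory.congr_hom ((extendScalarsComp f g).app M).hom_inv_id _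

lemma tmul_id_one_injective (N : ModuleCat.{u} S) :
    Function.Injective (fun n : N ↦ tmul (RingHom.id S) 1 n) :=
  (ConcreteCategory.bijective_of_isIso ((extendScalarsId S).inv.app N)).1

end

section

variable {B E : Type u} [CommRing B] [CommRing E] (p : B →+* E) (N : ModuleCat.{u} E)

lemma squareMap_id_id (x : (extendScalars.{u, u, u} p).obj ((restrictScalars.{u, u, u} p).obj N)) :
    squareMap p p (RingHom.id E) (RingHom.id E) rfl N x =
      tmul (RingHom.id E) 1 ((extendRestrictScalarsAdj.{u} p).counit.app N x : N) := by
  induction x using ExtendScalars.induction with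
  | zero => rw [map_zero, map_zero]; exact (ExtendScalars.tmul_zero _ _).symm
  | add x y hx hy =>
    rw [map_add, map_add, hx, hy]
    exact (ExtendScalars.tmul_add _ _ _ _).symm
  | tmul e n =>
    have key (n : N) : tmul (RingHom.id E) e n = tmul (RingHom.id E) 1 (e • n) := by
      rw [ExtendScalars.tmul_smul, one_mul]; rfl
    exact key n

/-- The first coprojection `E → (E ⊗_B E) ⊗_B E`, where `E ⊗_B E` is a `B`-algebra through its
second factor. -/
noncomputable def coproj₁ : E →+* Pushout p ((Pushout.inr p p).comp p) :=
  (Pushout.inl p ((Pushout.inr p p).comp p)).comp (Pushout.inl p p)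

/-- The second coprojection `E → (E ⊗_B E) ⊗_B E`. -/
noncomputable def coproj₂ : E →+* Pushout p ((Pushout.inr p p).comp p) :=
  (Pushout.inl p ((Pushout.inr p p).comp p)).comp (Pushout.inr p p)

/-- The third coprojection `E → (E ⊗_B E) ⊗_B E`. -/
noncomputable def coproj₃ : E →+* Pushout p ((Pushout.inr p p).comp p) :=
  Pushout.inr p ((Pushout.inr p p).comp p)

lemma coproj₁_comp : (coproj₁ p).comp p = (coproj₂ p).comp p := by
  rw [coproj₁, RingHom.comp_assoc, Pushout.inl_comp]; rfl

lemma coproj₂_comp : (coproj₂ p).comp p = (coproj₃ p).comp p :=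
  Pushout.inl_comp p ((Pushout.inr p p).comp p)

/-- The map `E ⊗_B (E ⊗_B N) → ((E ⊗_B E) ⊗_B E) ⊗_E N` sending `e ⊗ (e' ⊗ n)` to
`((e ⊗ e') ⊗ 1) ⊗ n`. -/
noncomputable def tripleMap :
    (extendScalars.{u, u, u} p).obj ((restrictScalars.{u, u, u} p).obj
      ((extendScalars.{u, u, u} p).obj ((restrictScalars.{u, u, u} p).obj N))) →+
      (extendScalars.{u, u, u} (coproj₃ p)).obj N :=
  (squareMap p ((Pushout.inr p p).comp p) _ _ (Pushout.inl_comp _ _) N).comp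
    (((extendScalarsComp p (Pushout.inr p p)).inv.app
      ((restrictScalars.{u, u, u} p).obj N)).hom.toAddMonoidHom.comp
      (squareMap p p _ _ (Pushout.inl_comp p p)
        ((extendScalars.{u, u, u} p).obj ((restrictScalars.{u, u, u} p).obj N))))

lemma tripleMap_injective : Function.Injective (tripleMap p N) :=
  (Pushout.squareMap_bijective p ((Pushout.inr p p).comp p) N).1.comp
    ((ConcreteCategory.bijective_of_isIso ((extendScalarsComp p (Pushout.inr p p)).inv.app
      ((restrictScalars.{u, u, u} p).obj N))).1.comp (Pushout.squareMap_bijective p p _).1)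

lemma tripleMap_tmul (e : E)
    (x : (extendScalars.{u, u, u} p).obj ((restrictScalars.{u, u, u} p).obj N)) :
    tripleMap p N (tmul p e (M := (restrictScalars.{u, u, u} p).obj
      ((extendScalars.{u, u, u} p).obj ((restrictScalars.{u, u, u} p).obj N))) x) =
      coproj₁ p e • squareMap p p (coproj₂ p) (coproj₃ p) (coproj₂_comp p) N x := by
  induction x using ExtendScalars.induction with
  | zero =>
    rw [map_zero, smul_zero]
    exact (congrArg _ (ExtendScalars.tmul_zero p e)).trans (map_zero _)
  | add x y hx hy =>
    rw [map_add, smul_add, ← hx, ← hy, ← map_add]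
    exact congrArg _ (ExtendScalars.tmul_add p e _ _)
  | tmul e' n =>
    have h1 := extendScalarsComp_inv_app_tmul_tmul p (Pushout.inr p p)
      ((restrictScalars.{u, u, u} p).obj N) (Pushout.inl p p e) e' n
    have h2 := congrArg (squareMap p ((Pushout.inr p p).comp p) _ _ (Pushout.inl_comp _ _) N) h1
    refine Eq.trans h2 ?_
    have key (n : N) : tmul (coproj₃ p) (Pushout.inl p ((Pushout.inr p p).comp p)
        (Pushout.inl p p e * Pushout.inr p p e')) n =
        coproj₁ p e • tmul (coproj₃ p) (coproj₂ p e') n := by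
      rw [smul_tmul_eq, map_mul]; rfl
    exact key n

end

end ModuleCat.ExtendScalars

/-! ### Descent data for modules -/

section

open ModuleCat ExtendScalars

variable {B E : Type u} [CommRing B] [CommRing E]

variable (p : B →+* E) in
/-- Descent data for modules relative to the ring homomorphism `p`. -/
abbrev ModuleDescentData : Type (u + 1) :=
  modulesIndexedCategory.{u}.DescentData (fun _ : Unit ↦ (CommRingCat.ofHom p).op)

namespace ModuleDescentData

variable {p : B →+* E} (D : ModuleDescentData p)

/-- The underlying `E`-module of a descent datum. -/
def module : ModuleCat.{u} E := D.obj ()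

section

variable {A : Type u} [CommRing A] (f₁ f₂ : E →+* A) (h : f₁.comp p = f₂.comp p)

/-- The gluing morphism `f₁^* N → f₂^* N` of a descent datum on `N`, for ring homomorphisms `f₁`
and `f₂` that agree on `B`. -/
def gluing : (extendScalars.{u, u, u} f₁).obj D.module ⟶
    (extendScalars.{u, u, u} f₂).obj D.module :=
  D.hom (i₁ := ()) (i₂ := ()) (CommRingCat.ofHom (f₁.comp p)).op (CommRingCat.ofHom f₁).op
    (CommRingCat.ofHom f₂).op rfl (by rw [h]; rfl)

lemma gluing_eq_hom : D.gluing f₁ f₂ h =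
    D.hom (i₁ := ()) (i₂ := ()) (CommRingCat.ofHom (f₁.comp p)).op (CommRingCat.ofHom f₁).op
      (CommRingCat.ofHom f₂).op rfl (by rw [h]; rfl) :=
  rfl

lemma gluing_self : D.gluing f₁ f₁ rfl = 𝟙 _ :=
  D.hom_self (i := ()) (CommRingCat.ofHom (f₁.comp p)).op (CommRingCat.ofHom f₁).op rfl

lemma gluing_comp_gluing (f₃ : E →+* A) (h' : f₂.comp p = f₃.comp p) :
    D.gluing f₁ f₂ h ≫ D.gluing f₂ f₃ h' = D.gluing f₁ f₃ (h.trans h') := by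
  have := D.hom_comp (i₁ := ()) (i₂ := ()) (i₃ := ()) (CommRingCat.ofHom (f₁.comp p)).op
    (CommRingCat.ofHom f₁).op (CommRingCat.ofHom f₂).op (CommRingCat.ofHom f₃).op rfl
    (by rw [h]; rfl) (by rw [h, h']; rfl)
  refine Eq.trans ?_ this
  congr 1
  unfold gluing
  congr 2
  exact congrArg CommRingCat.ofHom h.symm

/-- Gluing morphisms are compatible with extension of scalars along `g`, here on the elements
`1 ⊗ n`, which generate. -/
lemma gluing_tmul_one {A' : Type u} [CommRing A'] (g : A →+* A') (n : D.module) :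
    D.gluing (g.comp f₁) (g.comp f₂) (by rw [RingHom.comp_assoc, h, RingHom.comp_assoc])
      (tmul (g.comp f₁) 1 n) =
      baseChange f₂ g (g.comp f₂) rfl D.module (D.gluing f₁ f₂ h (tmul f₁ 1 n)) := by
  have h1 : D.gluing (g.comp f₁) (g.comp f₂) (by rw [RingHom.comp_assoc, h, RingHom.comp_assoc]) =
      (modulesIndexedCategoryComp f₁ g _ rfl D.module).hom ≫
        (extendScalars.{u, u, u} g).map (D.gluing f₁ f₂ h) ≫
          (modulesIndexedCategoryComp f₂ g _ rfl D.module).inv :=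
    (D.pullHom_hom (i₁ := ()) (i₂ := ()) (CommRingCat.ofHom g).op (CommRingCat.ofHom (f₁.comp p)).op
      (CommRingCat.ofHom ((g.comp f₁).comp p)).op rfl (CommRingCat.ofHom f₁).op
      (CommRingCat.ofHom f₂).op rfl (by rw [h]; rfl) (CommRingCat.ofHom (g.comp f₁)).op
      (CommRingCat.ofHom (g.comp f₂)).op rfl rfl).symm
  rw [h1, ← Category.assoc]
  apply (ConcreteCategory.bijective_of_isIso
    (modulesIndexedCategoryComp f₂ g _ rfl D.module).hom).1
  rw [← ConcreteCategory.comp_apply, Category.assoc, Iso.inv_hom_id, Category.comp_id,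
    modulesIndexedCategoryComp_hom_baseChange, ConcreteCategory.comp_apply,
    modulesIndexedCategoryComp_hom_tmul]
  rfl

end

end ModuleDescentData

/-! ### Descent data as coalgebras -/

/-- A morphism of modules from an additive map that respects scalars. -/
def ModuleCat.homOfAddMonoidHom {R : Type*} [Ring R] {N P : ModuleCat.{u} R} (φ : N →+ P)
    (h : ∀ (r : R) n, φ (r • n) = r • φ n) : N ⟶ P :=
  ModuleCat.ofHom { φ with map_smul' := h }

namespace ModuleDescentData

variable {p : B →+* E} (D : ModuleDescentData p)

/-- Over `E ⊗_B E`, the target `(E ⊗_B E) ⊗_E N` of a gluing morphism is `E ⊗_B N`. -/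
noncomputable def squareEquiv (N : ModuleCat.{u} E) :
    (extendScalars.{u, u, u} p).obj ((restrictScalars.{u, u, u} p).obj N) ≃+
      (extendScalars.{u, u, u} (Pushout.inr p p)).obj N :=
  AddEquiv.ofBijective _ (Pushout.squareMap_bijective p p N)

/-- The map `N → E ⊗_B N` that a morphism of `E ⊗_B E`-modules from the first to the second
extension of scalars of `N` restricts to. -/
noncomputable def coactionOfHom {N : ModuleCat.{u} E}
    (θ : (extendScalars.{u, u, u} (Pushout.inl p p)).obj N ⟶
      (extendScalars.{u, u, u} (Pushout.inr p p)).obj N) :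
    N ⟶ (extendScalars.{u, u, u} p).obj ((restrictScalars.{u, u, u} p).obj N) :=
  homOfAddMonoidHom
    (AddMonoidHom.mk' (fun n ↦ (squareEquiv N).symm (θ (tmul _ 1 n)))
      fun n n' ↦ by rw [ExtendScalars.tmul_add, map_add, map_add])
    (fun e n ↦ by
      refine (AddEquiv.symm_apply_eq _).2 ?_
      refine Eq.trans ?_ (squareMap_smul p p _ _ (Pushout.inl_comp p p) N e _).symm
      refine Eq.trans ?_ (congrArg (Pushout.inl p p e • ·)
        ((squareEquiv N).apply_symm_apply _).symm)
      rw [ExtendScalars.tmul_smul, one_mul, ← map_smul, smul_tmul_eq, mul_one])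

lemma squareMap_coactionOfHom {N : ModuleCat.{u} E}
    (θ : (extendScalars.{u, u, u} (Pushout.inl p p)).obj N ⟶
      (extendScalars.{u, u, u} (Pushout.inr p p)).obj N) (n : N) :
    squareMap p p _ _ (Pushout.inl_comp p p) N (coactionOfHom θ n) = θ (tmul _ 1 n) :=
  (squareEquiv N).apply_symm_apply _

lemma gluing_tmul {A : Type u} [CommRing A] (f₁ f₂ : E →+* A) (h : f₁.comp p = f₂.comp p) (t : A)
    (n : D.module) :
    D.gluing f₁ f₂ h (tmul f₁ t n) = t • D.gluing f₁ f₂ h (tmul f₁ 1 n) := by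
  rw [← map_smul, smul_tmul_eq, mul_one]

/-- The coaction `N → E ⊗_B N` of a descent datum on `N`: the restriction to `N` of the gluing
morphism over `E ⊗_B E`. -/
noncomputable def coaction : D.module ⟶
    (extendScalars.{u, u, u} p).obj ((restrictScalars.{u, u, u} p).obj D.module) :=
  coactionOfHom (D.gluing (Pushout.inl p p) (Pushout.inr p p) (Pushout.inl_comp p p))

/-- The coaction determines all gluing morphisms: any pair `f₁`, `f₂` that agrees on `B` factors
through the two coprojections of `E ⊗_B E`. -/
lemma squareMap_coaction {A : Type u} [CommRing A] (f₁ f₂ : E →+* A)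
    (h : f₁.comp p = f₂.comp p) (n : D.module) :
    squareMap p p f₁ f₂ h D.module (D.coaction n) = D.gluing f₁ f₂ h (tmul f₁ 1 n) := by
  obtain ⟨g, rfl, rfl⟩ := Pushout.exists_lift p p f₁ f₂ h
  rw [gluing_tmul_one _ _ _ (Pushout.inl_comp p p),
    ← baseChange_squareMap p p _ _ (Pushout.inl_comp p p)]
  exact congrArg _ (squareMap_coactionOfHom _ n)

/-- The normalization of a descent datum along the multiplication `E ⊗_B E → E` is the counit law of
its coaction. -/
lemma coaction_counit :
    D.coaction ≫ (extendRestrictScalarsAdj.{u} p).counit.app D.module = 𝟙 _ := by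
  ext n
  apply tmul_id_one_injective
  refine (squareMap_id_id p D.module (D.coaction n)).symm.trans ?_
  rw [squareMap_coaction, gluing_self]
  rfl

lemma tripleMap_map_coaction
    (x : (extendScalars.{u, u, u} p).obj ((restrictScalars.{u, u, u} p).obj D.module)) :
    tripleMap p D.module ((extendScalars.{u, u, u} p).map
      ((restrictScalars.{u, u, u} p).map D.coaction) x) =
      D.gluing (coproj₂ p) (coproj₃ p) (coproj₂_comp p)
        (squareMap p p (coproj₁ p) (coproj₂ p) (coproj₁_comp p) D.module x) := by
  induction x using ExtendScalars.induction with
  | zero => simp only [map_zero]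
  | add x y hx hy => simp only [map_add, hx, hy]
  | tmul e n =>
    have key (n : D.module) : coproj₁ p e •
        squareMap p p (coproj₂ p) (coproj₃ p) (coproj₂_comp p) D.module (D.coaction n) =
        D.gluing (coproj₂ p) (coproj₃ p) (coproj₂_comp p) (tmul _ (coproj₁ p e) n) := by
      rw [squareMap_coaction, ← gluing_tmul]
    exact (tripleMap_tmul p D.module e (D.coaction n)).trans (key n)

lemma tripleMap_map_unit (N : ModuleCat.{u} E)
    (x : (extendScalars.{u, u, u} p).obj ((restrictScalars.{u, u, u} p).obj N)) :
    tripleMap p N ((extendScalars.{u, u, u} p).map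
      ((extendRestrictScalarsAdj.{u} p).unit.app ((restrictScalars.{u, u, u} p).obj N)) x) =
      squareMap p p (coproj₁ p) (coproj₃ p) ((coproj₁_comp p).trans (coproj₂_comp p)) N x := by
  induction x using ExtendScalars.induction with
  | zero => simp only [map_zero]
  | add x y hx hy => simp only [map_add, hx, hy]
  | tmul e n =>
    have key (n : N) : coproj₁ p e • tmul (coproj₃ p) (coproj₂ p 1) n =
        tmul (coproj₃ p) (coproj₁ p e) n := by
      rw [smul_tmul_eq, map_one, mul_one]
    exact (tripleMap_tmul p N e
      (tmul p (M := (restrictScalars.{u, u, u} p).obj N) 1 n)).trans (key n)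

/-- The cocycle condition of a descent datum is the coassociativity of its coaction. -/
lemma coaction_coassoc :
    D.coaction ≫ (extendScalars.{u, u, u} p).map
      ((extendRestrictScalarsAdj.{u} p).unit.app ((restrictScalars.{u, u, u} p).obj D.module)) =
    D.coaction ≫ (extendScalars.{u, u, u} p).map
      ((restrictScalars.{u, u, u} p).map D.coaction) := by
  ext n
  apply tripleMap_injective
  refine (tripleMap_map_unit D.module (D.coaction n)).trans
    (Eq.trans ?_ (tripleMap_map_coaction D (D.coaction n)).symm)
  rw [squareMap_coaction, squareMap_coaction,
    ← D.gluing_comp_gluing _ _ (coproj₁_comp p) _ (coproj₂_comp p)]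
  rfl

/-- The coalgebra over the comonad `E ⊗_B -` that a descent datum defines. -/
noncomputable def coalgebra : (extendRestrictScalarsAdj.{u} p).toComonad.Coalgebra where
  A := D.module
  a := D.coaction
  counit := D.coaction_counit
  coassoc := D.coaction_coassoc

variable {D} {D' : ModuleDescentData p}

/-- The underlying linear map of a morphism of descent data. -/
def homModule (φ : D ⟶ D') : D.module ⟶ D'.module := φ.hom ()

lemma homModule_gluing (φ : D ⟶ D') {A : Type u} [CommRing A] (f₁ f₂ : E →+* A)
    (h : f₁.comp p = f₂.comp p) :
    (extendScalars.{u, u, u} f₁).map (homModule φ) ≫ D'.gluing f₁ f₂ h =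
      D.gluing f₁ f₂ h ≫ (extendScalars.{u, u, u} f₂).map (homModule φ) :=
  φ.comm (i₁ := ()) (i₂ := ()) (CommRingCat.ofHom (f₁.comp p)).op (CommRingCat.ofHom f₁).op
    (CommRingCat.ofHom f₂).op rfl (by rw [h]; rfl)

lemma coaction_naturality (φ : D ⟶ D') :
    D.coaction ≫ (extendScalars.{u, u, u} p).map ((restrictScalars.{u, u, u} p).map (homModule φ)) =
      homModule φ ≫ D'.coaction := by
  ext n
  apply (Pushout.squareMap_bijective p p _).1
  refine (squareMap_map p p _ _ (Pushout.inl_comp p p) (homModule φ) (D.coaction n)).trans ?_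
  refine Eq.trans ?_ (squareMap_coaction D' _ _ (Pushout.inl_comp p p) (homModule φ n)).symm
  rw [squareMap_coaction]
  exact (ConcreteCategory.congr_hom (homModule_gluing φ _ _ (Pushout.inl_comp p p))
    (tmul _ 1 n)).symm

/-- A linear map that respects the coactions is a morphism of descent data. -/
lemma gluing_naturality_of_coaction (φ : D.module ⟶ D'.module)
    (hφ : D.coaction ≫ (extendScalars.{u, u, u} p).map ((restrictScalars.{u, u, u} p).map φ) =
      φ ≫ D'.coaction) {A : Type u} [CommRing A] (f₁ f₂ : E →+* A) (h : f₁.comp p = f₂.comp p) :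
    (extendScalars.{u, u, u} f₁).map φ ≫ D'.gluing f₁ f₂ h =
      D.gluing f₁ f₂ h ≫ (extendScalars.{u, u, u} f₂).map φ := by
  refine ExtendScalars.hom_ext fun n ↦ ?_
  refine (squareMap_coaction D' f₁ f₂ h (φ n)).symm.trans ?_
  refine (congrArg _ (ConcreteCategory.congr_hom hφ n).symm).trans ?_
  refine (squareMap_map p p f₁ f₂ h φ (D.coaction n)).trans ?_
  rw [squareMap_coaction]
  rfl

variable (p) in
/-- The functor from descent data to coalgebras over the comonad `E ⊗_B -`. -/
noncomputable def toCoalgebra :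
    ModuleDescentData p ⥤ (extendRestrictScalarsAdj.{u} p).toComonad.Coalgebra where
  obj D := D.coalgebra
  map φ := { f := homModule φ, h := coaction_naturality φ }
  map_id _ := rfl
  map_comp _ _ := rfl

instance : (toCoalgebra p).Faithful where
  map_injective h := by
    ext i
    exact congrArg Comonad.Coalgebra.Hom.f h

instance : (toCoalgebra p).Full where
  map_surjective {D D'} ψ :=
    -- the data are indexed by one object, so a morphism is a single linear map
    ⟨{ hom := fun _ ↦ ψ.f
       comm := fun Y q _ _ f₁ f₂ hf₁ hf₂ ↦ by
        subst hf₁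
        exact gluing_naturality_of_coaction (D := D) (D' := D') ψ.f ψ.h f₁.unop.hom
          f₂.unop.hom (congrArg (fun g ↦ g.unop.hom) hf₂.symm) }, rfl⟩

variable (p) in
/-- The canonical descent datum on `E ⊗_B M`. -/
noncomputable abbrev canonical (M : ModuleCat.{u} B) : ModuleDescentData p :=
  (modulesIndexedCategory.{u}.toDescentData (fun _ : Unit ↦ (CommRingCat.ofHom p).op)).obj M

lemma gluing_canonical (M : ModuleCat.{u} B) {A : Type u} [CommRing A] (f₁ f₂ : E →+* A)
    (h : f₁.comp p = f₂.comp p) :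
    (canonical p M).gluing f₁ f₂ h = canonicalGluing p f₁ f₂ _ rfl h.symm M :=
  ((canonical p M).gluing_eq_hom f₁ f₂ h).trans
    (modulesIndexedCategory.{u}.toDescentData_obj_hom (S := op (CommRingCat.of B))
      (X := fun _ : Unit ↦ op (CommRingCat.of E)) (fun _ : Unit ↦ (CommRingCat.ofHom p).op) M
      (CommRingCat.ofHom (f₁.comp p)).op (i₁ := ()) (i₂ := ()) (CommRingCat.ofHom f₁).op
      (CommRingCat.ofHom f₂).op rfl (by rw [h]; rfl))

variable (p) in
/-- The identity of `E ⊗_B M`, as an isomorphism to the module underlying the canonical descent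
datum. -/
noncomputable def canonicalIso (M : ModuleCat.{u} B) :
    (extendScalars.{u, u, u} p).obj M ≅ (canonical p M).module := Iso.refl _

lemma gluing_canonicalIso_tmul (M : ModuleCat.{u} B) {A : Type u} [CommRing A] (f₁ f₂ : E →+* A)
    (h : f₁.comp p = f₂.comp p) (m : M) :
    (canonical p M).gluing f₁ f₂ h (tmul f₁ 1 ((canonicalIso p M).hom (tmul p 1 m))) =
      tmul f₂ 1 ((canonicalIso p M).hom (tmul p 1 m)) := by
  have h1 : (canonicalIso p M).hom (tmul p 1 m) = tmul p 1 m := rfl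
  rw [gluing_canonical, h1]
  exact canonicalGluing_tmul p f₁ f₂ _ rfl h.symm M 1 m

lemma squareMap_map_unit (M : ModuleCat.{u} B) {A : Type u} [CommRing A] (f₁ f₂ : E →+* A)
    (h : f₁.comp p = f₂.comp p) (m : M) :
    squareMap p p f₁ f₂ h ((extendScalars.{u, u, u} p).obj M)
      ((extendScalars.{u, u, u} p).map ((extendRestrictScalarsAdj.{u} p).unit.app M)
        (tmul p 1 m)) = tmul f₂ 1 (tmul p 1 m) := by
  have h1 : (extendScalars.{u, u, u} p).map ((extendRestrictScalarsAdj.{u} p).unit.app M)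
      (tmul p 1 m) = tmul p 1 (M := (restrictScalars.{u, u, u} p).obj
        ((extendScalars.{u, u, u} p).obj M)) (tmul p 1 m) := rfl
  rw [h1]
  refine (squareMap_tmul p p f₁ f₂ h ((extendScalars.{u, u, u} p).obj M) 1 (tmul p 1 m)).trans ?_
  rw [map_one]

/-- If the gluing morphism sends `1 ⊗ n` to `1 ⊗ n` for each image `n` of some `1 ⊗ m` under a map
`E ⊗_B M → N`, then that map respects the coactions. -/
lemma comp_coaction_of_gluing {M : ModuleCat.{u} B}
    (ι : (extendScalars.{u, u, u} p).obj M ⟶ D.module)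
    (hι : ∀ m : M, D.gluing (Pushout.inl p p) (Pushout.inr p p) (Pushout.inl_comp p p)
      (tmul _ 1 (ι (tmul p 1 m))) = tmul _ 1 (ι (tmul p 1 m))) :
    (extendScalars.{u, u, u} p).map ((extendRestrictScalarsAdj.{u} p).unit.app M) ≫
      (extendScalars.{u, u, u} p).map ((restrictScalars.{u, u, u} p).map ι) =
      ι ≫ D.coaction := by
  refine ExtendScalars.hom_ext fun m ↦ ?_
  apply (Pushout.squareMap_bijective p p _).1
  have h1 := squareMap_coaction D _ _ (Pushout.inl_comp p p) (ι (tmul p 1 m))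
  have h2 := squareMap_map p p _ _ (Pushout.inl_comp p p) ι
    ((extendScalars.{u, u, u} p).map ((extendRestrictScalarsAdj.{u} p).unit.app M) (tmul p 1 m))
  have h3 := squareMap_map_unit M _ _ (Pushout.inl_comp p p) m
  exact (h2.trans (congrArg _ h3)).trans (h1.trans (hι m)).symm

lemma coaction_canonical (M : ModuleCat.{u} B) :
    (extendScalars.{u, u, u} p).map ((extendRestrictScalarsAdj.{u} p).unit.app M) ≫
      (extendScalars.{u, u, u} p).map ((restrictScalars.{u, u, u} p).map (canonicalIso p M).hom) =
      (canonicalIso p M).hom ≫ (canonical p M).coaction :=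
  comp_coaction_of_gluing _ (gluing_canonicalIso_tmul M _ _ (Pushout.inl_comp p p))

variable (p) in
/-- Under the functor to coalgebras, canonical descent data go to canonical coalgebras. -/
noncomputable def comparisonIsoToDescentDataComp :
    Comonad.comparison (extendRestrictScalarsAdj.{u} p) ≅
    (modulesIndexedCategory.{u}.toDescentData (fun _ : Unit ↦ (CommRingCat.ofHom p).op) ⋙
      toCoalgebra p : ModuleCat.{u} B ⥤ _) :=
  NatIso.ofComponents
    (fun M ↦ Comonad.Coalgebra.isoMk (canonicalIso p M) (coaction_canonical M))
    (fun φ ↦ by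
      apply Comonad.Coalgebra.Hom.ext
      exact (Category.comp_id _).trans (Category.id_comp _).symm)

end ModuleDescentData

variable {p : B →+* E}

/-- The functor from descent data to coalgebras is fully faithful, and essentially surjective as
soon as the comparison functor, which factors through it, is so. -/
lemma isEffectiveDescentForModules_of_comparison
    (h : (Comonad.comparison (extendRestrictScalarsAdj.{u} p)).IsEquivalence) :
    IsEffectiveDescentForModules p := by
  let Φ : ModuleCat.{u} B ⥤ ModuleDescentData p :=
    modulesIndexedCategory.{u}.toDescentData (fun _ : Unit ↦ (CommRingCat.ofHom p).op)
  have h1 : (Φ ⋙ ModuleDescentData.toCoalgebra p).IsEquivalence :=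
    (Functor.isEquivalence_iff_of_iso
      (ModuleDescentData.comparisonIsoToDescentDataComp p)).1 h
  have : (ModuleDescentData.toCoalgebra p).EssSurj :=
    ⟨fun Y ↦ ⟨Φ.obj ((Φ ⋙ ModuleDescentData.toCoalgebra p).objPreimage Y),
      ⟨(Φ ⋙ ModuleDescentData.toCoalgebra p).objObjPreimageIso Y⟩⟩⟩
  have : (ModuleDescentData.toCoalgebra p).IsEquivalence := { }
  exact Functor.isEquivalence_of_comp_right Φ (ModuleDescentData.toCoalgebra p)

/-- A morphism of canonical descent data is determined by its underlying linear map, the image under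
extension of scalars. -/
lemma IsEffectiveDescentForModules.faithful (h : IsEffectiveDescentForModules p) :
    (extendScalars.{u, u, u} p).Faithful where
  map_injective {_ _} _ _ hφψ :=
    (Functor.IsEquivalence.faithful (self := h)).map_injective
      (Pseudofunctor.DescentData.hom_ext fun _ ↦ hφψ)

end

/-! ### Descent, comonadicity and purity -/

theorem theorem2p4 {B E : Type u} [CommRing B] [CommRing E] (p : B →+* E) :
    (IsEffectiveDescentForModules p ↔ IsPureRingHom p) ∧
      (IsComonadic (ModuleCat.extendScalars.{u, u, u} p) ↔ IsPureRingHom p) :=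
  ⟨⟨fun h ↦ (isPureRingHom_iff_faithful p).2 h.faithful,
    fun h ↦ isEffectiveDescentForModules_of_comparison h.isEquivalence_comparison⟩,
    isComonadic_iff_isPureRingHom⟩
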